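/- **Theorem 1.15.** Let $T$ be a topological semigroup with identity $e$ acting jointly continuously on a compact Hausdorff (not necessarily metrizable) space $X$, with $ex=x$ and $(st)x=s(tx)$. For $t\in T$ and $A\subseteq X$ write $t^{-1}A=\{z\in X: tz\in A\}$ and $t^{-1}x=t^{-1}\{x\}$; let $\mathscr U_X$ be the unique compatible uniformity of $X$. Assume that * $(T,X)$ is minimal: every orbit $Tx$ is dense in $X$; * $(T,X)$ is bi-continuous: every $x\mapsto tx$ is onto and every set-valued map $x\mapsto t^{-1}x$ is continuous, i.e. for all $t\in T$, $x_0\in X$, $\varepsilon\in\mathscr U_X$ there is $\delta\in\mathscr U_X$ such that $(x_0,x)\in\delta$ implies $t^{-1}x\subseteq\varepsilon[t^{-1}x_0]$ and $t^{-1}x_0\subseteq\varepsilon[t^{-1}x]$, where $\varepsilon[A]=\{y:\exists a\in A,\ (a,y)\in\varepsilon\}$; * $(T,X)$ admits an invariant measure: there is a Borel probability measure $\mu$ on $X$ with $\mu(t^{-1}B)=\mu(B)$ for all $t\in T$ and all Borel sets $B$. For $x\in X$ define: * $Q[x]$, the set of $x'\in X$ for which there are nets $x_n\to x$, $x_n'\to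 x'$ in $X$ and $t_n\in T$ such that $\lim t_nx_n=\lim t_nx'_n$ (both limits exist); * $V[x]$, the set of $x'\in X$ for which there are a net $x_n'\to x'$, a net $t_n\in T$ and $y\in X$ with $t_nx\to y$ and $t_nx_n'=y$ for all $n$; * $D[x]=\bigcap_{\varepsilon\in\mathscr U_X}\overline{\{y\in X:\exists a,b\in A_\varepsilon,\ ay=bx\}}$, where $A_\varepsilon=\{t\in T:(x,tx)\in\varepsilon\}$. A point $x$ is almost automorphic (a.a.) if $t_nx\to y$, $x_n'\to x'$ and $t_nx_n'=y$ for nets $t_n\in T$, $x'_n\in X$ imply $x=x'$; $(T,X)$ is a.a. if some a.a. point has a dense orbit. Let $S_{eq}$ be the least closed $T$-invariant equivalence relation on $X$ whose quotient semiflow is equicontinuous ($(T,Y)$ is equicontinuous if for every $\varepsilon\in\mathscr U_Y$ there is $\delta\in\mathscr U_Y$ with $(ty,ty')\in\varepsilon$ for all $(y,y')\in\delta$, $t\in T$), and let $\pi:X\to X_{eq}=X/S_{eq}$ be the canonical projection. Then: 1. $D[x]=Q[x]$ for all $x\in X$. 2. If $(T,X)$ is invertible (every $x\mapsto tx$ is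 bijective), then $Q[x]=D[x]=\overline{V[x]}$ for all $x\in X$. 3. $(T,X)$ is a.a. if and only if $\pi$ is of almost 1-1 type, i.e. some fibre $\pi^{-1}(y)$, $y\in X_{eq}$, is a singleton. Moreover, if $X$ is metrizable and $(T,X)$ is a.a., then the set of a.a. points is a residual subset of $X$. -/

import Mathlib

open Set Filter Topology MeasureTheory

/- A semiflow `(T, X)` is given by a topological monoid `T`, a compact Hausdorff space `X`, and a
jointly continuous monoid action of `T` on `X`, that is by the classes `[Monoid T]
[TopologicalSpace T] [ContinuousMul T] [TopologicalSpace X] [CompactSpace X] [T2Space X]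
[MulAction T X] [ContinuousSMul T X]`.  Minimality is Mathlib's `MulAction.IsMinimal T X`
(every orbit `T x` is dense).

Nets are encoded by filters: a net `n ↦ (t_n, x_n, ...)` in a product space is a proper filter `F`
on that product, and a limit relation between the terms is a `Tendsto` statement along `F`, while a
relation which holds for the terms of the net is an "eventually" statement along `F`. -/

namespace Semiflow

section Basic

/-- The uniform structure of a compact Hausdorff space: its entourages are the neighbourhoods of
the diagonal. -/
def entourages (X : Type*) [TopologicalSpace X] : Filter (X × X) := 𝓝ˢ (diagonal X)

/-- It is the uniformity of every compatible uniform structure. -/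
theorem entourages_eq_uniformity (X : Type*) [UniformSpace X] [CompactSpace X] :
    entourages X = uniformity X := nhdsSet_diagonal_eq_uniformity

/-- The set `ε[A] = ⋃ a ∈ A, {y | (a, y) ∈ ε}`. -/
def thicken {X : Type*} (ε : Set (X × X)) (A : Set X) : Set X := {y | ∃ a ∈ A, (a, y) ∈ ε}

variable (T : Type*) {X : Type*} [Monoid T] [TopologicalSpace X] [MulAction T X]

variable (X) in
/-- Every `x ↦ t x` is onto. -/
def IsSurjective : Prop := ∀ t : T, Function.Surjective (fun x : X => t • x)

variable (X) in
/-- Every `x ↦ t x` is one-to-one and onto. -/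
def IsInvertible : Prop := ∀ t : T, Function.Bijective (fun x : X => t • x)

/-- Continuity at `x₀` of a set-valued map. -/
def SetValuedContinuousAt (f : X → Set X) (x₀ : X) : Prop :=
  ∀ ε ∈ entourages X, ∃ δ ∈ entourages X, ∀ x, (x₀, x) ∈ δ →
    f x ⊆ thicken ε (f x₀) ∧ f x₀ ⊆ thicken ε (f x)

variable (X) in
/-- The semiflow is surjective, and for each `t` the set-valued map `x ↦ t⁻¹ x` is continuous. -/
def IsBicontinuous : Prop :=
  IsSurjective T X ∧
    ∀ (t : T) (x₀ : X), SetValuedContinuousAt (fun x : X => (fun z : X => t • z) ⁻¹' {x}) x₀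

variable (X) in
/-- There is a Borel probability measure on `X` with `μ (t⁻¹ B) = μ B` for all `t` and all
Borel sets `B`. -/
def AdmitsInvariantMeasure [MeasurableSpace X] [BorelSpace X] : Prop :=
  ∃ μ : Measure X, IsProbabilityMeasure μ ∧ SMulInvariantMeasure T X μ

variable (X) in
/-- For every `ε` there is `δ` with `T δ ⊆ ε`. -/
def IsEquicontinuous : Prop :=
  ∀ ε ∈ entourages X, ∃ δ ∈ entourages X, ∀ p ∈ δ, ∀ t : T, (t • p.1, t • p.2) ∈ ε

/-- `Q[x]`, the set of points `x'` to which `x` is regionally proximal: there are nets `x_n → x`,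
`x'_n → x'` and `t_n` with `lim t_n x_n = lim t_n x'_n`. -/
def Q (x : X) : Set X :=
  {x' | ∃ (F : Filter (T × X × X)) (z : X), F.NeBot ∧
    Tendsto (fun p => p.2.1) F (𝓝 x) ∧ Tendsto (fun p => p.2.2) F (𝓝 x') ∧
    Tendsto (fun p => p.1 • p.2.1) F (𝓝 z) ∧ Tendsto (fun p => p.1 • p.2.2) F (𝓝 z)}

/-- `V[x]`, the set of points `x'` such that there are nets `x'_n → x'` and `t_n` and a point `y`
with `t_n x → y` and `t_n x'_n = y`. -/
def V (x : X) : Set X :=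
  {x' | ∃ (F : Filter (T × X)) (y : X), F.NeBot ∧
    Tendsto (fun p => p.2) F (𝓝 x') ∧ Tendsto (fun p => p.1 • x) F (𝓝 y) ∧
    ∀ᶠ p in F, p.1 • p.2 = y}

/-- The return times `N_T(x, ε[x])`. -/
def returnTimes (x : X) (ε : Set (X × X)) : Set T := {t | (x, t • x) ∈ ε}

/-- `D[x] = ⋂ ε, closure (A⁻¹ A x)` with `A = N_T(x, ε[x])`. -/
def D (x : X) : Set X :=
  ⋂ ε ∈ entourages X,
    closure {y | ∃ a ∈ returnTimes T x ε, ∃ b ∈ returnTimes T x ε, a • y = b • x}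

/-- `x` is an almost automorphic point: whenever `t_n x → y`, `x'_n → x'` and `t_n x'_n = y`,
one has `x = x'`. -/
def IsAlmostAutomorphicPt (x : X) : Prop :=
  ∀ (F : Filter (T × X)) (y x' : X), F.NeBot →
    Tendsto (fun p => p.1 • x) F (𝓝 y) → Tendsto (fun p => p.2) F (𝓝 x') →
    (∀ᶠ p in F, p.1 • p.2 = y) → x = x'

variable (X) in
/-- There is an almost automorphic point with dense orbit. -/
def IsAlmostAutomorphic : Prop :=
  ∃ x : X, IsAlmostAutomorphicPt T x ∧ Dense (MulAction.orbit T x)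

/-- Epimorphisms of semiflows. -/
structure IsEpimorphism {Y : Type*} [TopologicalSpace Y] [MulAction T Y] (π : X → Y) : Prop where
  continuous : Continuous π
  surjective : Function.Surjective π
  map_smul : ∀ (t : T) (x : X), π (t • x) = t • π x

/-- Epimorphisms of almost 1-1 type: some fibre is a singleton. -/
def IsAlmostOneToOne {Y : Type*} [TopologicalSpace Y] [MulAction T Y] (π : X → Y) : Prop :=
  IsEpimorphism T π ∧ ∃ (y : Y) (x : X), π ⁻¹' {y} = {x}

end Basic

/-- Closed `T`-invariant equivalence relations on `X`. -/
structure ClosedInvariantRel (T X : Type*) [Monoid T] [TopologicalSpace X] [MulAction T X] extends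
    Setoid X where
  isClosed : IsClosed {p : X × X | r p.1 p.2}
  invariant : ∀ (t : T) {x y : X}, r x y → r (t • x) (t • y)

namespace ClosedInvariantRel

variable {T X : Type*} [Monoid T] [TopologicalSpace X] [MulAction T X]

/-- The factor `X / R`, with the quotient topology. -/
def Factor (R : ClosedInvariantRel T X) : Type _ := Quotient R.toSetoid

instance (R : ClosedInvariantRel T X) : TopologicalSpace R.Factor :=
  inferInstanceAs (TopologicalSpace (Quotient R.toSetoid))

instance (R : ClosedInvariantRel T X) [CompactSpace X] : CompactSpace R.Factor :=
  inferInstanceAs (CompactSpace (Quotient R.toSetoid))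

/-- The canonical projection `X → X / R`. -/
def proj (R : ClosedInvariantRel T X) (x : X) : R.Factor := Quotient.mk R.toSetoid x

/-- The action `t R[x] = R[t x]`. -/
instance (R : ClosedInvariantRel T X) : MulAction T R.Factor where
  smul t := Quotient.map (fun x => t • x) (fun _ _ h => R.invariant t h)
  one_smul := by
    rintro ⟨x⟩
    exact congrArg R.proj (one_smul T x)
  mul_smul s t := by
    rintro ⟨x⟩
    exact congrArg R.proj (mul_smul s t x)

theorem proj_eq_iff (R : ClosedInvariantRel T X) {x y : X} : R.proj x = R.proj y ↔ R.r x y :=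
  Quotient.eq (r := R.toSetoid)

theorem isQuotientMap_proj (R : ClosedInvariantRel T X) : IsQuotientMap R.proj :=
  isQuotientMap_quotient_mk'

theorem isEpimorphism_proj (R : ClosedInvariantRel T X) : IsEpimorphism T R.proj :=
  ⟨R.isQuotientMap_proj.continuous, R.isQuotientMap_proj.surjective, fun _ _ => rfl⟩

theorem isClosedMap_proj [CompactSpace X] (R : ClosedInvariantRel T X) :
    IsClosedMap R.proj := by
  intro K hK
  rw [← R.isQuotientMap_proj.isClosed_preimage]
  have h : R.proj ⁻¹' (R.proj '' K) = Prod.snd '' ({p : X × X | R.r p.1 p.2} ∩ Prod.fst ⁻¹' K) := by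
    ext y
    constructor
    · rintro ⟨x, hx, hxy⟩
      exact ⟨(x, y), ⟨R.proj_eq_iff.1 hxy, hx⟩, rfl⟩
    · rintro ⟨⟨x, y'⟩, ⟨h1, h2⟩, rfl⟩
      exact ⟨x, h2, R.proj_eq_iff.2 h1⟩
  rw [h]
  exact isClosedMap_snd_of_compactSpace _ (R.isClosed.inter (hK.preimage continuous_fst))

instance [CompactSpace X] [T2Space X] (R : ClosedInvariantRel T X) : T2Space R.Factor := by
  refine ⟨fun a b hab => ?_⟩
  obtain ⟨x, rfl⟩ := R.isQuotientMap_proj.surjective a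
  obtain ⟨y, rfl⟩ := R.isQuotientMap_proj.surjective b
  have hc : ∀ z : X, IsClosed (R.proj ⁻¹' {R.proj z}) := fun z => by
    have h := R.isClosedMap_proj _ (isClosed_singleton (x := z))
    rw [image_singleton] at h
    exact h.preimage R.isQuotientMap_proj.continuous
  have hd : Disjoint (R.proj ⁻¹' {R.proj x}) (R.proj ⁻¹' {R.proj y}) :=
    (disjoint_singleton.2 hab).preimage _
  obtain ⟨U, V, hU, hV, hxU, hyV, hUV⟩ := normal_separation (hc x) (hc y) hd
  refine ⟨(R.proj '' Uᶜ)ᶜ, (R.proj '' Vᶜ)ᶜ, (R.isClosedMap_proj _ hU.isClosed_compl).isOpen_compl,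
    (R.isClosedMap_proj _ hV.isClosed_compl).isOpen_compl, ?_, ?_, ?_⟩
  · rintro ⟨z, hz, hzx⟩
    exact hz (hxU hzx)
  · rintro ⟨z, hz, hzx⟩
    exact hz (hyV hzx)
  · rw [Set.disjoint_left]
    intro c h1 h2
    obtain ⟨z, rfl⟩ := R.isQuotientMap_proj.surjective c
    have hzU : z ∈ U := by_contra fun h => h1 ⟨z, h, rfl⟩
    have hzV : z ∈ V := by_contra fun h => h2 ⟨z, h, rfl⟩
    exact Set.disjoint_left.1 hUV hzU hzV

/-- The action on the factor is jointly continuous, so that the factor is a semiflow. -/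
instance [TopologicalSpace T] [ContinuousSMul T X] [CompactSpace X] [T2Space X]
    (R : ClosedInvariantRel T X) : ContinuousSMul T R.Factor := by
  have hp : IsProperMap (Prod.map (id : T → T) R.proj) :=
    isProperMap_id.prodMap R.isQuotientMap_proj.continuous.isProperMap
  have hq : IsQuotientMap (Prod.map (id : T → T) R.proj) :=
    hp.isClosedMap.isQuotientMap hp.continuous
      (Function.surjective_id.prodMap R.isQuotientMap_proj.surjective)
  refine ⟨hq.continuous_iff.2 ?_⟩
  exact R.isQuotientMap_proj.continuous.comp (continuous_smul (M := T) (X := X))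

end ClosedInvariantRel

section MaximalEquicontinuousFactor

variable (T X : Type*) [Monoid T] [TopologicalSpace X] [MulAction T X]

/-- The equicontinuous structure relation `S_eq(X)`: the intersection of all closed invariant
equivalence relations `R` for which `X / R` is equicontinuous. It is itself the least of these
relations, see `eqStructureRel_le` and `isEquicontinuous_factor_eqStructureRel`. -/
def eqStructureRel : ClosedInvariantRel T X where
  r x y := ∀ R : ClosedInvariantRel T X, IsEquicontinuous T R.Factor → R.r x y
  iseqv :=
    { refl := fun x R _ => R.refl x
      symm := fun h R hR => R.symm (h R hR)
      trans := fun h h' R hR => R.trans (h R hR) (h' R hR) }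
  isClosed := by
    simp only [Set.ofPred_forall]
    exact isClosed_iInter fun R => isClosed_iInter fun _ => R.isClosed
  invariant t _ _ h R hR := R.invariant t (h R hR)

/-- The maximal equicontinuous factor `X_eq = X / S_eq(X)`. -/
abbrev MaxEquicontinuousFactor : Type _ := (eqStructureRel T X).Factor

/-- The canonical projection `X → X_eq`. -/
abbrev projEq : X → MaxEquicontinuousFactor T X := (eqStructureRel T X).proj

variable {T X}

theorem eqStructureRel_le (R : ClosedInvariantRel T X) (hR : IsEquicontinuous T R.Factor)
    {x y : X} (h : (eqStructureRel T X).r x y) : R.r x y := h R hR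

variable (T X) in
theorem isEquicontinuous_factor_eqStructureRel [CompactSpace X] [T2Space X] :
    IsEquicontinuous T (MaxEquicontinuousFactor T X) := by
  intro ε hε
  obtain ⟨O, hO, hdO, hOε⟩ := mem_nhdsSet_iff_exists.1 hε
  suffices h : ∃ δ ∈ entourages (MaxEquicontinuousFactor T X),
      ∀ p ∈ δ, ∀ t : T, (t • p.1, t • p.2) ∉ Oᶜ by
    obtain ⟨δ, hδ, h⟩ := h
    exact ⟨δ, hδ, fun p hp t => hOε (not_not.1 (h p hp t))⟩
  refine IsCompact.induction_on (p := fun K => ∃ δ ∈ entourages (MaxEquicontinuousFactor T X),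
      ∀ p ∈ δ, ∀ t : T, (t • p.1, t • p.2) ∉ K) hO.isClosed_compl.isCompact ?_ ?_ ?_ ?_
  · exact ⟨univ, univ_mem, fun _ _ _ h => h⟩
  · rintro s s' hs ⟨δ, hδ, h⟩
    exact ⟨δ, hδ, fun p hp t hm => h p hp t (hs hm)⟩
  · rintro s s' ⟨δ, hδ, h⟩ ⟨δ', hδ', h'⟩
    exact ⟨δ ∩ δ', inter_mem hδ hδ', fun p hp t hm => hm.elim (h p hp.1 t) (h' p hp.2 t)⟩
  · rintro ⟨a, b⟩ hab
    have hne : a ≠ b := fun h => hab (hdO h)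
    obtain ⟨x, rfl⟩ := (eqStructureRel T X).isQuotientMap_proj.surjective a
    obtain ⟨y, rfl⟩ := (eqStructureRel T X).isQuotientMap_proj.surjective b
    have hxy : ¬ (eqStructureRel T X).r x y := fun h =>
      hne ((eqStructureRel T X).proj_eq_iff.2 h)
    obtain ⟨R, hR, hRxy⟩ : ∃ R : ClosedInvariantRel T X, IsEquicontinuous T R.Factor ∧
        ¬ R.r x y := by
      by_contra hcon
      push Not at hcon
      exact hxy hcon
    let q : MaxEquicontinuousFactor T X → R.Factor :=
      Quotient.lift R.proj (fun _ _ h => R.proj_eq_iff.2 (eqStructureRel_le R hR h))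
    have hq : Continuous q := R.isQuotientMap_proj.continuous.quotient_lift _
    have hqs : ∀ (t : T) c, q (t • c) = t • q c := by
      rintro t ⟨c⟩
      rfl
    have hqne : (q (projEq T X x), q (projEq T X y)) ∉ diagonal R.Factor := fun h =>
      hRxy (R.proj_eq_iff.1 h)
    obtain ⟨N, W, hN, hW, hxN, hdW, hNW⟩ := normal_separation
      (isClosed_singleton (x := (q (projEq T X x), q (projEq T X y))))
      (isClosed_diagonal (X := R.Factor)) (disjoint_singleton_left.2 hqne)
    obtain ⟨δ, hδ, h⟩ := hR W (hW.mem_nhdsSet.2 hdW)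
    refine ⟨Prod.map q q ⁻¹' N, mem_nhdsWithin_of_mem_nhds
      ((hN.preimage (hq.prodMap hq)).mem_nhds (hxN rfl)), Prod.map q q ⁻¹' δ,
      (hq.prodMap hq).tendsto_nhdsSet mapsTo_prodMap_diagonal hδ, fun p hp t hm => ?_⟩
    have h1 := h _ hp t
    have h2 : (t • q p.1, t • q p.2) ∈ N := by
      rw [← hqs, ← hqs]
      exact hm
    exact Set.disjoint_left.1 hNW h2 h1

end MaximalEquicontinuousFactor

end Semiflow

/-! The invariant measure turns closed invariant sets into invariant continuous pseudometrics. Take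
it regular, `ν`; by minimality it has full support. Let `M ⊆ X × X` be closed and invariant, with
fibres `M_x`. Since `M_x ⊆ t⁻¹ M_{tx}`, the number `ν(M_x)` does not decrease along orbits; as it is
upper semicontinuous in `x`, minimality makes it constant. The same inclusion for unions and
intersections of two fibres then shows that `d_M(x, y) = ν(M_x ∆ M_y)` is invariant and continuous.
If `d_M(x, y) = 0`, full support forces every open subset of `M_x` into `M_y`.

The relation "`d_M(x, x') = 0` for all `M`" has an equicontinuous factor, so it contains `S_eq`. Two
choices of `M` close the circle `D[x] ⊆ Q[x] ⊆ S_eq[x] ⊆ D[x]`. For a pair in `Q` that some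
equicontinuous factor separates, take the pairs whose orbit avoids a neighbourhood of the separated
pair (`rel_of_mem_Q`). For a pair in `S_eq`, take the closure of `T({x} × U)` with `U` a
neighbourhood of `x'` (`mem_D_of_fibreDist_eq_zero`); here bi-continuity enters, through openness of
the translations.

Openness also gives `D[x] ⊆ closure V[x]`, by a recursion on return times
(`exists_seq_smul_mem_of_mem_D`) followed by a compactness argument. Hence `V[x] = {x}`, which is
almost automorphy, means that the fibre of `π` through `x` is a singleton. -/

namespace Semiflow

open scoped symmDiff

/-! ### Regularity and full support of the invariant measure -/

section InvariantMeasure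

variable {T X : Type*} [Monoid T] [TopologicalSpace X] [CompactSpace X]
  [MulAction T X] [ContinuousConstSMul T X] [MeasurableSpace X] [BorelSpace X]

/-- The invariant measure may be taken regular. -/
theorem AdmitsInvariantMeasure.exists_regular [T2Space X] (h : AdmitsInvariantMeasure T X) :
    ∃ ν : Measure X, ν.Regular ∧ IsProbabilityMeasure ν ∧ SMulInvariantMeasure T X ν := by
  obtain ⟨μ, hμ, hinv⟩ := h
  obtain ⟨ν, hreg, hfin, hν⟩ := μ.exists_regular_eq_of_compactSpace
  refine ⟨ν, hreg, ⟨?_⟩, ⟨fun t s hs => ?_⟩⟩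
  · have h1 := hν 1
    simp only [BoundedContinuousFunction.coe_one, Pi.one_apply, integral_const, smul_eq_mul,
      mul_one, probReal_univ] at h1
    rw [← ENNReal.toReal_eq_one_iff]
    exact h1.symm
  · have hc : Continuous fun x : X => t • x := continuous_const_smul t
    -- Regular finite measures are determined by the integrals of continuous functions, and on these
    -- `ν` agrees with the invariant `μ`.
    have hmap : (ν.map fun x : X => t • x) = ν := by
      have : (ν.map fun x : X => t • x).InnerRegularCompactLTTop :=
        Measure.InnerRegularCompactLTTop.map_of_continuous hc
      have : IsFiniteMeasure (ν.map fun x : X => t • x) := Measure.isFiniteMeasure_map _ _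
      refine Measure.ext_of_integral_eq_on_compactlySupported fun f => ?_
      have hμmap : (μ.map fun x : X => t • x) = μ := by
        ext s hs
        rw [Measure.map_apply hc.measurable hs, hinv.measure_preimage_smul t hs]
      let g : BoundedContinuousFunction X ℝ :=
        BoundedContinuousFunction.mkOfCompact ⟨f, f.continuous⟩
      let g' : BoundedContinuousFunction X ℝ :=
        BoundedContinuousFunction.mkOfCompact ⟨fun x => f (t • x), f.continuous.comp hc⟩
      have e1 : ∫ x, f x ∂μ = ∫ x, f x ∂ν := hν g
      have e2 : ∫ x, f (t • x) ∂μ = ∫ x, f (t • x) ∂ν := hν g'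
      have hf : Continuous f := f.continuous
      rw [integral_map hc.aemeasurable hf.aestronglyMeasurable, ← e2, ← e1,
        ← integral_map hc.aemeasurable hf.aestronglyMeasurable, hμmap]
    rw [← Measure.map_apply hc.measurable hs, hmap]

/-- An invariant measure of a minimal semiflow has full support. -/
theorem isOpenPosMeasure_of_isMinimal [MulAction.IsMinimal T X] (ν : Measure X)
    [IsProbabilityMeasure ν] [SMulInvariantMeasure T X ν] : ν.IsOpenPosMeasure := by
  refine ⟨fun U hU hne h0 => ?_⟩
  -- By minimality and compactness finitely many sets `t⁻¹ U` cover `X`, and each is as null as `U`.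
  obtain ⟨s, hs⟩ := isCompact_univ.elim_finite_subcover (fun t : T => (fun x : X => t • x) ⁻¹' U)
    (fun t => hU.preimage (continuous_const_smul t)) (hU.iUnion_preimage_smul T hne).ge
  have h1 : ν (⋃ t ∈ s, (fun x : X => t • x) ⁻¹' U) = 0 := by
    refine (measure_biUnion_null_iff s.countable_toSet).2 fun t _ => ?_
    rw [SMulInvariantMeasure.measure_preimage_smul t hU.measurableSet, h0]
  have h2 := measure_mono_null hs h1
  simp at h2

end InvariantMeasure

/-! ### Semicontinuity of fibre measures -/

section Fibres

variable {X Z : Type*} [TopologicalSpace X] [CompactSpace X] [TopologicalSpace Z]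

/-- The measure of the fibres of a closed set is upper semicontinuous. -/
theorem upperSemicontinuous_measureReal_fibre [MeasurableSpace X] (ν : Measure X)
    [ν.OuterRegular] [IsFiniteMeasure ν] {N : Set (Z × X)} (hN : IsClosed N) :
    UpperSemicontinuous fun z => ν.real (Prod.mk z ⁻¹' N) := by
  intro z r hr
  have hr0 : 0 ≤ r := measureReal_nonneg.trans hr.le
  have hr' : ν (Prod.mk z ⁻¹' N) < ENNReal.ofReal r :=
    (ENNReal.lt_ofReal_iff_toReal_lt (measure_ne_top _ _)).2 hr
  obtain ⟨O, hNO, hO, hlt⟩ := (Prod.mk z ⁻¹' N).exists_isOpen_lt_of_lt _ hr'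
  -- The points whose fibre leaves `O` form a closed set, being a projection along the compact space
  -- `X`; so all fibres near `z` stay in `O`.
  have hC : IsClosed (Prod.fst '' (N ∩ Prod.snd ⁻¹' Oᶜ)) :=
    isClosedMap_fst_of_compactSpace _ (hN.inter (hO.isClosed_compl.preimage continuous_snd))
  have hz : z ∉ Prod.fst '' (N ∩ Prod.snd ⁻¹' Oᶜ) := by
    rintro ⟨⟨z', x⟩, ⟨h1, h2⟩, rfl⟩
    exact h2 (hNO h1)
  filter_upwards [hC.isOpen_compl.mem_nhds hz] with w hw
  refine (ENNReal.lt_ofReal_iff_toReal_lt (measure_ne_top _ _)).1 (lt_of_le_of_lt ?_ hlt)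
  refine measure_mono fun x hx => by_contra fun hxO => hw ⟨(w, x), ⟨hx, hxO⟩, rfl⟩

end Fibres

/-! ### The pseudometric of a closed set -/

section FibreDist

variable {X : Type*} [MeasurableSpace X] (ν : Measure X)

/-- The pseudometric `ν (M_x ∆ M_y)` given by the fibres of a set `M ⊆ X × X`. -/
noncomputable def fibreDist (M : Set (X × X)) (x y : X) : ℝ :=
  ν.real ((Prod.mk x ⁻¹' M) ∆ (Prod.mk y ⁻¹' M))

theorem fibreDist_self (M : Set (X × X)) (x : X) :
    fibreDist ν M x x = 0 := by
  simp [fibreDist]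

theorem fibreDist_comm (M : Set (X × X)) (x y : X) :
    fibreDist ν M x y = fibreDist ν M y x := by
  simp [fibreDist, symmDiff_comm]

theorem fibreDist_triangle [IsFiniteMeasure ν]
    (M : Set (X × X)) (x y z : X) :
    fibreDist ν M x z ≤ fibreDist ν M x y + fibreDist ν M y z :=
  measureReal_symmDiff_le _

theorem fibreDist_nonneg (M : Set (X × X)) (x y : X) :
    0 ≤ fibreDist ν M x y := measureReal_nonneg

variable [TopologicalSpace X] {M : Set (X × X)} [IsFiniteMeasure ν]

/-- If two fibres agree up to a null set, the second contains every open subset of the first. -/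
theorem subset_fibre_of_fibreDist_eq_zero [ν.IsOpenPosMeasure] {x y : X} (hM : IsClosed M)
    (h : fibreDist ν M x y = 0) {U : Set X} (hU : IsOpen U) (hUx : U ⊆ Prod.mk x ⁻¹' M) :
    U ⊆ Prod.mk y ⁻¹' M := by
  have h0 : ν ((Prod.mk x ⁻¹' M) ∆ (Prod.mk y ⁻¹' M)) = 0 :=
    (measureReal_eq_zero_iff (measure_ne_top _ _)).1 h
  have hopen : IsOpen (U \ Prod.mk y ⁻¹' M) := hU.sdiff (hM.preimage (by fun_prop))
  have h1 : ν (U \ Prod.mk y ⁻¹' M) = 0 :=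
    measure_mono_null (fun z hz => Or.inl ⟨hUx hz.1, hz.2⟩) h0
  exact sdiff_eq_empty.1 (hopen.measure_eq_zero_iff ν |>.1 h1)

variable [BorelSpace X]

/-- Once all fibres have equal measure, this and the intersection formula express the pseudometric
both through unions and, with opposite sign, through intersections; each yields one half of
invariance and of continuity. -/
theorem measureReal_union_fibres (hM : IsClosed M) (x y : X) :
    2 * ν.real (Prod.mk x ⁻¹' M ∪ Prod.mk y ⁻¹' M) =
      ν.real (Prod.mk x ⁻¹' M) + ν.real (Prod.mk y ⁻¹' M) + fibreDist ν M x y := by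
  have hx : MeasurableSet (Prod.mk x ⁻¹' M) := (hM.preimage (by fun_prop)).measurableSet
  have hy : MeasurableSet (Prod.mk y ⁻¹' M) := (hM.preimage (by fun_prop)).measurableSet
  have h1 := measureReal_union_add_inter (μ := ν) (s := Prod.mk x ⁻¹' M) hy
  have h2 := measureReal_symmDiff_eq (μ := ν) hx hy
  have h3 := measureReal_inter_add_sdiff (μ := ν) (s := Prod.mk x ⁻¹' M) hy
  have h4 := measureReal_inter_add_sdiff (μ := ν) (s := Prod.mk y ⁻¹' M) hx
  rw [inter_comm] at h4
  rw [fibreDist]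
  linarith

theorem measureReal_inter_fibres (hM : IsClosed M) (x y : X) :
    2 * ν.real (Prod.mk x ⁻¹' M ∩ Prod.mk y ⁻¹' M) =
      ν.real (Prod.mk x ⁻¹' M) + ν.real (Prod.mk y ⁻¹' M) - fibreDist ν M x y := by
  have h1 := measureReal_union_add_inter (μ := ν) (s := Prod.mk x ⁻¹' M)
    (hM.preimage (f := Prod.mk y) (by fun_prop)).measurableSet
  have h2 := measureReal_union_fibres ν hM x y
  linarith

/-- Monotonicity of an invariant measure along translations. -/
theorem measureReal_le_of_subset_preimage_smul {T : Type*} [Monoid T] [MulAction T X]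
    [SMulInvariantMeasure T X ν]
    (t : T) {A B : Set X} (hB : IsClosed B) (h : A ⊆ (fun x => t • x) ⁻¹' B) :
    ν.real A ≤ ν.real B := by
  refine (measureReal_mono h).trans_eq ?_
  rw [measureReal_def, SMulInvariantMeasure.measure_preimage_smul t hB.measurableSet,
    measureReal_def]

end FibreDist

/-! ### Invariance and continuity of the pseudometric -/

section InvariantSets

variable {T X : Type*} [Monoid T] [TopologicalSpace X] [MulAction T X]

variable (T) in
/-- Closed `T`-invariant subsets of `X × X`. -/
structure IsClosedInvariant (M : Set (X × X)) : Prop where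
  isClosed : IsClosed M
  smul_mem : ∀ (t : T) {x y : X}, (x, y) ∈ M → (t • x, t • y) ∈ M

variable [CompactSpace X] [MeasurableSpace X] [BorelSpace X] {M : Set (X × X)} (ν : Measure X)
  [ν.OuterRegular] [IsFiniteMeasure ν]
  [SMulInvariantMeasure T X ν] [MulAction.IsMinimal T X]

/-- The fibres of a closed invariant set of a minimal semiflow have the same measure. -/
theorem IsClosedInvariant.measureReal_fibre_eq (hM : IsClosedInvariant T M) (x y : X) :
    ν.real (Prod.mk x ⁻¹' M) = ν.real (Prod.mk y ⁻¹' M) := by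
  suffices h : ∀ x y : X, ν.real (Prod.mk x ⁻¹' M) ≤ ν.real (Prod.mk y ⁻¹' M) from
    le_antisymm (h x y) (h y x)
  intro x y
  by_contra! hlt
  have husc := upperSemicontinuous_measureReal_fibre ν hM.isClosed
  -- The points whose fibre is smaller than that of `x` form a nonempty open set, which the orbit of
  -- `x` must enter; but fibre measure cannot drop along an orbit.
  obtain ⟨t, ht⟩ := (husc.isOpen_preimage (ν.real (Prod.mk x ⁻¹' M))).exists_smul_mem T x ⟨y, hlt⟩
  exact (measureReal_le_of_subset_preimage_smul ν t (hM.isClosed.preimage (by fun_prop))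
    (fun z hz => hM.smul_mem t hz)).not_gt ht

/-- A translation can only enlarge the union of two fibres, so the distance does not decrease; it
can only enlarge their intersection, so the distance does not increase. -/
theorem IsClosedInvariant.fibreDist_smul (hM : IsClosedInvariant T M) (t : T) (x y : X) :
    fibreDist ν M (t • x) (t • y) = fibreDist ν M x y := by
  have hc : ∀ x : X, IsClosed (Prod.mk x ⁻¹' M) := fun x => hM.isClosed.preimage (by fun_prop)
  have h1 := measureReal_le_of_subset_preimage_smul (T := T) ν t
    (A := Prod.mk x ⁻¹' M ∪ Prod.mk y ⁻¹' M) ((hc (t • x)).union (hc (t • y)))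
    (fun z hz => hz.imp (hM.smul_mem t) (hM.smul_mem t))
  have h2 := measureReal_le_of_subset_preimage_smul (T := T) ν t
    (A := Prod.mk x ⁻¹' M ∩ Prod.mk y ⁻¹' M) ((hc (t • x)).inter (hc (t • y)))
    (fun z hz => hz.imp (hM.smul_mem t) (hM.smul_mem t))
  have h3 := measureReal_union_fibres ν hM.isClosed
  have h4 := measureReal_inter_fibres ν hM.isClosed
  have h5 := hM.measureReal_fibre_eq (T := T) ν
  linarith [h3 x y, h3 (t • x) (t • y), h4 x y, h4 (t • x) (t • y), h5 x (t • x), h5 y (t • y)]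

/-- Unions and intersections of two fibres are themselves fibres of closed sets over `X × X`, so
their measures are upper semicontinuous. The intersection gives lower semicontinuity of the
distance, the union upper semicontinuity. -/
theorem IsClosedInvariant.continuous_fibreDist (hM : IsClosedInvariant T M) :
    Continuous fun p : X × X => fibreDist ν M p.1 p.2 := by
  have h1 := upperSemicontinuous_measureReal_fibre ν (Z := X × X) (X := X)
    (N := {q | (q.1.1, q.2) ∈ M ∨ (q.1.2, q.2) ∈ M})
    ((hM.isClosed.preimage (f := fun q : (X × X) × X => (q.1.1, q.2)) (by fun_prop)).union
      (hM.isClosed.preimage (f := fun q : (X × X) × X => (q.1.2, q.2)) (by fun_prop)))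
  have h2 := upperSemicontinuous_measureReal_fibre ν (Z := X × X) (X := X)
    (N := {q | (q.1.1, q.2) ∈ M ∧ (q.1.2, q.2) ∈ M})
    ((hM.isClosed.preimage (f := fun q : (X × X) × X => (q.1.1, q.2)) (by fun_prop)).inter
      (hM.isClosed.preimage (f := fun q : (X × X) × X => (q.1.2, q.2)) (by fun_prop)))
  have h3 := measureReal_union_fibres ν hM.isClosed
  have h4 := measureReal_inter_fibres ν hM.isClosed
  have h5 := hM.measureReal_fibre_eq (T := T) ν
  rw [continuous_iff_lower_upperSemicontinuous]
  constructor
  · rintro ⟨x, y⟩ r hr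
    dsimp only at hr
    have := h2 (x, y) (ν.real (Prod.mk x ⁻¹' M) - r / 2) (by
      change ν.real (Prod.mk x ⁻¹' M ∩ Prod.mk y ⁻¹' M) < _
      linarith [h4 x y, h5 x y])
    filter_upwards [this] with ⟨a, b⟩ hab
    change ν.real (Prod.mk a ⁻¹' M ∩ Prod.mk b ⁻¹' M) < _ at hab
    change r < fibreDist ν M a b
    linarith [h4 a b, h5 a x, h5 b x]
  · rintro ⟨x, y⟩ r hr
    dsimp only at hr
    have := h1 (x, y) (ν.real (Prod.mk x ⁻¹' M) + r / 2) (by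
      change ν.real (Prod.mk x ⁻¹' M ∪ Prod.mk y ⁻¹' M) < _
      linarith [h3 x y, h5 x y])
    filter_upwards [this] with ⟨a, b⟩ hab
    change ν.real (Prod.mk a ⁻¹' M ∪ Prod.mk b ⁻¹' M) < _ at hab
    change fibreDist ν M a b < r
    linarith [h3 a b, h5 a x, h5 b x]

/-- By invariance the distances along the net are the same before and after translation; they tend
to `d_M(x, x')` before and to `d_M(z, z) = 0` after. -/
theorem fibreDist_eq_zero_of_mem_Q {x x' : X} (hM : IsClosedInvariant T M) (h : x' ∈ Q T x) :
    fibreDist ν M x x' = 0 := by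
  obtain ⟨F, z, hF, h1, h2, h3, h4⟩ := h
  have hc := hM.continuous_fibreDist (T := T) ν
  have e1 := (hc.tendsto (x, x')).comp (h1.prodMk_nhds h2)
  have e2 := (hc.tendsto (z, z)).comp (h3.prodMk_nhds h4)
  have e3 : ((fun p : X × X => fibreDist ν M p.1 p.2) ∘
      fun p : T × X × X => (p.1 • p.2.1, p.1 • p.2.2)) =
      (fun p : X × X => fibreDist ν M p.1 p.2) ∘ fun p : T × X × X => (p.2.1, p.2.2) :=
    funext fun p => hM.fibreDist_smul ν p.1 p.2.1 p.2.2
  rw [e3] at e2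
  exact (tendsto_nhds_unique e1 e2).trans (fibreDist_self ν M z)

end InvariantSets

/-! ### Entourages and neighbourhoods -/

section Entourages

variable {X : Type*} [TopologicalSpace X]

theorem mem_nhds_of_mem_entourages {ε : Set (X × X)} (hε : ε ∈ entourages X) (x : X) :
    {y | (x, y) ∈ ε} ∈ 𝓝 x :=
  (Continuous.prodMk_right x).continuousAt.preimage_mem_nhds (nhds_le_nhdsSet (mem_diagonal x) hε)

/-- An entourage with prescribed section at `x` and no constraint elsewhere lets conditions based at
one point be tested on neighbourhoods instead of entourages. -/
theorem setOf_imp_mem_entourages [T1Space X] {x : X} {C : Set X} (hC : C ∈ 𝓝 x) :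
    {p : X × X | p.1 = x → p.2 ∈ C} ∈ entourages X := by
  refine mem_nhdsSet_iff_forall.2 ?_
  rintro ⟨a, b⟩ (rfl : a = b)
  by_cases h : a = x
  · subst h
    filter_upwards [continuous_snd.continuousAt.preimage_mem_nhds hC] with p hp _ using hp
  · filter_upwards [continuous_fst.continuousAt.preimage_mem_nhds
      (isOpen_compl_singleton.mem_nhds h)] with p hp hp' using (hp hp').elim

theorem entourages_swap {ε : Set (X × X)} (hε : ε ∈ entourages X) :
    Prod.swap ⁻¹' ε ∈ entourages X :=
  continuous_swap.tendsto_nhdsSet (s := diagonal X) (t := diagonal X)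
    (fun p (hp : p.1 = p.2) => hp.symm) hε

end Entourages

/-! ### Elementary relations between `D`, `Q`, `V` and almost automorphy -/

section Basic

variable {T X : Type*} [Monoid T] [TopologicalSpace X] [MulAction T X]

/-- This is the lower half of the continuity of `x ↦ t⁻¹ x`: a preimage `z` of `t z` is approximated
by preimages of every point near `t z`. -/
theorem IsBicontinuous.isOpenMap_smul [T1Space X] (h : IsBicontinuous T X) (t : T) :
    IsOpenMap fun x : X => t • x := by
  refine isOpenMap_iff_nhds_le.2 fun z W hW => ?_
  obtain ⟨δ, hδ, h'⟩ := h.2 t (t • z) _ (entourages_swap (setOf_imp_mem_entourages hW))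
  filter_upwards [mem_nhds_of_mem_entourages hδ (t • z)] with x hx
  obtain ⟨a, ha, haz⟩ := (h' x hx).2 (show z ∈ (fun z : X => t • z) ⁻¹' {t • z} from rfl)
  obtain rfl : t • a = x := ha
  exact haz rfl

theorem mem_D_iff [T1Space X] {x x' : X} : x' ∈ D T x ↔ ∀ C ∈ 𝓝 x,
    x' ∈ closure {y | ∃ a b : T, a • x ∈ C ∧ b • x ∈ C ∧ a • y = b • x} := by
  simp only [D, mem_iInter]
  constructor
  · intro h C hC
    refine closure_mono ?_ (h _ (setOf_imp_mem_entourages hC))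
    rintro y ⟨a, ha, b, hb, hab⟩
    exact ⟨a, b, ha rfl, hb rfl, hab⟩
  · intro h ε hε
    refine closure_mono ?_ (h _ (mem_nhds_of_mem_entourages hε x))
    rintro y ⟨a, b, ha, hb, hab⟩
    exact ⟨a, ha, b, hb, hab⟩

theorem isClosedInvariant_closure [ContinuousConstSMul T X] {S : Set (X × X)}
    (hS : ∀ (t : T) {x y : X}, (x, y) ∈ S → (t • x, t • y) ∈ S) :
    IsClosedInvariant T (closure S) :=
  ⟨isClosed_closure, fun t _ _ h => map_mem_closure (f := Prod.map (t • ·) (t • ·))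
    ((continuous_const_smul t).prodMap (continuous_const_smul t)) h fun _ hp => hS t hp⟩

theorem isClosed_D (x : X) : IsClosed (D T x) :=
  isClosed_biInter fun _ _ => isClosed_closure

theorem D_subset_Q [T1Space X] (x : X) : D T x ⊆ Q T x := by
  intro x' hx'
  -- This is the largest filter along which all four limits hold, with common limit `z = x`.
  -- Membership in `D[x]` is exactly what makes it proper: the triple `(a, x, y)` with `a y = b x`
  -- lies in a given basic set.
  refine ⟨comap (fun p : T × X × X => ((p.2.1, p.2.2), (p.1 • p.2.1, p.1 • p.2.2)))
    ((𝓝 x ×ˢ 𝓝 x') ×ˢ (𝓝 x ×ˢ 𝓝 x)), x, ?_, ?_, ?_, ?_, ?_⟩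
  · refine comap_neBot fun N hN => ?_
    obtain ⟨A, hA, B, hB, hAB⟩ := mem_prod_iff.1 hN
    obtain ⟨A₁, hA₁, A₂, hA₂, hA'⟩ := mem_prod_iff.1 hA
    obtain ⟨B₁, hB₁, B₂, hB₂, hB'⟩ := mem_prod_iff.1 hB
    obtain ⟨y, hy, a, b, ha, hb, hab⟩ := mem_closure_iff_nhds.1
      (mem_D_iff.1 hx' _ (inter_mem hB₁ hB₂)) A₂ hA₂
    exact ⟨(a, x, y), hAB ⟨hA' ⟨mem_of_mem_nhds hA₁, hy⟩, hB' ⟨ha.1, by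
      rw [hab]
      exact hb.2⟩⟩⟩
  · exact tendsto_fst.comp (tendsto_fst.comp tendsto_comap)
  · exact tendsto_snd.comp (tendsto_fst.comp tendsto_comap)
  · exact tendsto_fst.comp (tendsto_snd.comp tendsto_comap)
  · exact tendsto_snd.comp (tendsto_snd.comp tendsto_comap)

theorem V_subset_Q (x : X) : V T x ⊆ Q T x := by
  rintro x' ⟨F, y, hF, h1, h2, h3⟩
  refine ⟨F.map fun p => (p.1, x, p.2), y, hF.map _, ?_, ?_, ?_, ?_⟩ <;>
    rw [tendsto_map'_iff]
  · exact tendsto_const_nhds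
  · exact h1
  · exact h2
  · exact (tendsto_congr' h3).2 tendsto_const_nhds

theorem self_mem_V (x : X) : x ∈ V T x :=
  ⟨pure (1, x), x, inferInstance, tendsto_pure_nhds Prod.snd (1, x), by
    simpa using tendsto_pure_nhds (fun p : T × X => p.1 • x) (1, x), by simp⟩

theorem isAlmostAutomorphicPt_iff {x : X} : IsAlmostAutomorphicPt T x ↔ V T x = {x} := by
  constructor
  · intro h
    refine Subset.antisymm ?_ (singleton_subset_iff.2 (self_mem_V x))
    rintro x' ⟨F, y, hF, h1, h2, h3⟩
    exact (h F y x' hF h2 h1 h3).symm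
  · intro h F y x' hF h1 h2 h3
    have : x' ∈ V T x := ⟨F, y, hF, h2, h1, h3⟩
    rw [h] at this
    exact this.symm

/-- Translates of almost automorphic points are almost automorphic. -/
theorem IsAlmostAutomorphicPt.smul [CompactSpace X] [T2Space X] [ContinuousConstSMul T X]
    (hs : IsSurjective T X) {x : X} (h : IsAlmostAutomorphicPt T x) (s : T) :
    IsAlmostAutomorphicPt T (s • x) := by
  intro F y x' hF h1 h2 h3
  choose g hg using hs s
  dsimp only at hg
  let 𝒰 := Ultrafilter.of F
  have h𝒰 : (𝒰 : Filter (T × X)) ≤ F := Ultrafilter.of_le F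
  -- The points `x'_n` are lifted through `s`, and a limit `w` of the lifts is chosen along an
  -- ultrafilter. Almost automorphy of `x` for the net `t_n s` gives `w = x`, whence `x' = s w = s
  -- x`.
  obtain ⟨w, -, hw⟩ := isCompact_univ.ultrafilter_le_nhds (𝒰.map fun p => g p.2) (by simp)
  have hw' : Tendsto (fun p : T × X => g p.2) 𝒰 (𝓝 w) := hw
  have hxw : x = w := by
    refine h ((𝒰 : Filter (T × X)).map fun p => (p.1 * s, g p.2)) y w inferInstance ?_ ?_ ?_
    · rw [tendsto_map'_iff]
      simpa [Function.comp_def, mul_smul] using h1.mono_left h𝒰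
    · exact tendsto_map'_iff.2 hw'
    · rw [eventually_map]
      filter_upwards [h𝒰 h3] with p hp
      rw [mul_smul, hg]
      exact hp
  subst hxw
  refine tendsto_nhds_unique (((continuous_const_smul s).tendsto _).comp hw') ?_
  simpa only [Function.comp_def, hg] using h2.mono_left h𝒰

end Basic

/-! ### From return times to `V` -/

section DifferenceSets

variable {T X : Type*} [Monoid T] [TopologicalSpace X] [T2Space X] [MulAction T X]
  [ContinuousConstSMul T X]

/-- If every translation is open, then for every open neighbourhood `U` of a point of `D[x]` there
is a sequence `t_n` with `t_j x ∈ t_i U` for all `i < j`. -/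
theorem exists_seq_smul_mem_of_mem_D (hopen : ∀ t : T, IsOpenMap fun x : X => t • x) {x x' : X}
    (hx' : x' ∈ D T x) {U : Set X} (hU : IsOpen U) (hxU : x' ∈ U) :
    ∃ t : ℕ → T, ∀ i j, i < j → t j • x ∈ (fun z => t i • z) '' U := by
  -- A state is a pair `(c, O)` with `c x ∈ O` open. Choosing `a x, b x ∈ c⁻¹ O` and `y ∈ U` with `a
  -- y = b x`, the new term is `t = c a` and the new state is `(c b, O ∩ t U)`. All later terms send
  -- `x` into the shrunken set, hence into `t U`.
  have step : ∀ s : {s : T × Set X // IsOpen s.2 ∧ s.1 • x ∈ s.2}, ∃ (t : T)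
      (s' : {s : T × Set X // IsOpen s.2 ∧ s.1 • x ∈ s.2}),
      t • x ∈ s.1.2 ∧ s'.1.2 ⊆ s.1.2 ∩ (fun z => t • z) '' U := by
    rintro ⟨⟨c, O⟩, hO, hc⟩
    have hW : (fun z : X => c • z) ⁻¹' O ∈ 𝓝 x :=
      (hO.preimage (continuous_const_smul c)).mem_nhds hc
    obtain ⟨y, hyU, a, b, ha, hb, hab⟩ := mem_closure_iff.1 (mem_D_iff.1 hx' _ hW) U hU hxU
    refine ⟨c * a, ⟨(c * b, O ∩ (fun z => (c * a) • z) '' U), hO.inter (hopen _ _ hU), ?_, y, hyU,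
      ?_⟩, ?_, Subset.rfl⟩
    · simpa only [mul_smul, mem_preimage] using hb
    · simp only [mul_smul, hab]
    · simpa only [mul_smul, mem_preimage] using ha
  choose t next ht hnext using step
  let s : ℕ → {s : T × Set X // IsOpen s.2 ∧ s.1 • x ∈ s.2} :=
    fun n => Nat.rec ⟨(1, univ), isOpen_univ, mem_univ _⟩ (fun _ => next) n
  have hs : ∀ n, s (n + 1) = next (s n) := fun n => rfl
  have hanti : Antitone fun n => (s n).1.2 := antitone_nat_of_succ_le fun n => by
    rw [hs]
    exact fun z hz => (hnext _ hz).1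
  refine ⟨fun n => t (s n), fun i j hij => ?_⟩
  have h1 : t (s j) • x ∈ (s (i + 1)).1.2 := hanti (Nat.succ_le_of_lt hij) (ht (s j))
  rw [hs] at h1
  exact (hnext _ h1).2

/-- For `K` a closed neighbourhood of `x'`, a limit `y` of `t_n x` along an ultrafilter lies in
every compact set `t_i K`. Writing `y = t_i z_i` with `z_i ∈ K`, any limit of the `z_i` is a point
of `V[x]` in `K`. -/
theorem D_subset_closure_V [CompactSpace X] (hopen : ∀ t : T, IsOpenMap fun x : X => t • x)
    (x : X) :
    D T x ⊆ closure (V T x) := by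
  intro x' hx'
  refine mem_closure_iff_nhds.2 fun N hN => ?_
  obtain ⟨K, hK, hKc, hKN⟩ := exists_mem_nhds_isClosed_subset hN
  obtain ⟨t, ht⟩ := exists_seq_smul_mem_of_mem_D hopen hx' isOpen_interior
    (mem_interior_iff_mem_nhds.2 hK)
  let 𝒰 : Ultrafilter ℕ := Ultrafilter.of atTop
  have h𝒰 : (𝒰 : Filter ℕ) ≤ atTop := Ultrafilter.of_le _
  obtain ⟨y, -, hy⟩ := isCompact_univ.ultrafilter_le_nhds (𝒰.map fun n => t n • x) (by simp)
  have hy' : Tendsto (fun n => t n • x) 𝒰 (𝓝 y) := hy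
  have hz : ∀ i, ∃ z ∈ K, t i • z = y := by
    intro i
    have hc : IsClosed ((fun z => t i • z) '' K) :=
      (hKc.isCompact.image (continuous_const_smul (t i))).isClosed
    refine hc.mem_of_tendsto hy' ?_
    filter_upwards [h𝒰 (Ioi_mem_atTop i)] with j hj
    exact image_mono interior_subset (ht i j hj)
  choose z hzK hzy using hz
  obtain ⟨v, hvK, hv⟩ := hKc.isCompact.ultrafilter_le_nhds (𝒰.map z)
    (le_principal_iff.2 (Eventually.of_forall (f := (𝒰 : Filter ℕ)) hzK))
  have hv' : Tendsto z 𝒰 (𝓝 v) := hv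
  exact ⟨v, hKN hvK, (𝒰 : Filter ℕ).map fun n => (t n, z n), y, inferInstance,
    tendsto_map'_iff.2 hv', tendsto_map'_iff.2 hy', by simp [hzy]⟩

end DifferenceSets

/-! ### The relation of distance zero -/

section Minimal

variable {T X : Type*} [Monoid T] [TopologicalSpace X] [T2Space X] [MulAction T X]
  [ContinuousConstSMul T X] [MeasurableSpace X] [MulAction.IsMinimal T X] (ν : Measure X)
  [IsFiniteMeasure ν] [ν.IsOpenPosMeasure]

theorem mem_D_of_fibreDist_eq_zero (hopen : ∀ t : T, IsOpenMap fun x : X => t • x) {x x' : X}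
    (h : ∀ M, IsClosedInvariant T M → fibreDist ν M x x' = 0) : x' ∈ D T x := by
  refine mem_D_iff.2 fun C hC => mem_closure_iff.2 fun U hU hxU => ?_
  have hM : IsClosedInvariant T (closure {p : X × X | ∃ t : T, ∃ u ∈ U, p = (t • x, t • u)}) := by
    refine isClosedInvariant_closure ?_
    rintro s _ _ ⟨t, u, hu, hp⟩
    rw [Prod.mk.injEq] at hp
    exact ⟨s * t, u, hu, by rw [hp.1, hp.2, mul_smul, mul_smul]⟩
  -- The fibre over `x` contains `U`, hence so does the fibre over `x'`; in particular `(x', x') ∈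
  -- M`.
  have hx'M := subset_fibre_of_fibreDist_eq_zero ν hM.isClosed (h _ hM) hU
    (fun u hu => subset_closure ⟨1, u, hu, by simp⟩) hxU
  -- The diagonal part of `M` is closed and invariant, so by minimality it passes from `x'` to `x`.
  have hxM : x ∈ {z : X | (z, z) ∈ closure {p : X × X | ∃ t : T, ∃ u ∈ U, p = (t • x, t • u)}} := by
    have hcl := (hM.isClosed.preimage (f := fun z : X => (z, z)) (by fun_prop))
    refine hcl.closure_subset_iff.2 ?_ (MulAction.dense_orbit T x' x)
    rintro _ ⟨t, rfl⟩
    exact hM.smul_mem t hx'M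
  obtain ⟨_, ⟨h1, h2⟩, t, u, hu, rfl⟩ := mem_closure_iff.1 hxM (interior C ×ˢ interior C)
    (isOpen_interior.prod isOpen_interior)
    ⟨mem_interior_iff_mem_nhds.2 hC, mem_interior_iff_mem_nhds.2 hC⟩
  -- Since `t U` is open and meets the interior of `C`, the orbit of `x` enters both at once: `b x =
  -- t u'` with `b x ∈ C` and `u' ∈ U`, while `t x ∈ C` already.
  obtain ⟨b, hbC, u', hu', hb⟩ := (isOpen_interior.inter (hopen t U hU)).exists_smul_mem T x
    ⟨t • u, h2, u, hu, rfl⟩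
  exact ⟨u', hu', t, b, interior_subset h1, interior_subset hbC, hb⟩

variable [CompactSpace X] [BorelSpace X] [ν.OuterRegular] [SMulInvariantMeasure T X ν]

variable (T) in
/-- The closed invariant equivalence relation of being at distance zero for all the pseudometrics
`fibreDist ν M`. -/
def fibreRel : ClosedInvariantRel T X where
  r x y := ∀ M, IsClosedInvariant T M → fibreDist ν M x y = 0
  iseqv :=
    { refl := fun x M _ => fibreDist_self ν M x
      symm := fun h M hM => (fibreDist_comm ν M _ _).trans (h M hM)
      trans := fun {x y z} h h' M hM => le_antisymm
        (by simpa [h M hM, h' M hM] using fibreDist_triangle ν M x y z) (fibreDist_nonneg ν M x z) }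
  isClosed := by
    simp only [Set.ofPred_forall]
    exact isClosed_iInter fun M => isClosed_iInter fun hM =>
      isClosed_eq (hM.continuous_fibreDist (T := T) ν) continuous_const
  invariant t x y h M hM := (hM.fibreDist_smul ν t x y).trans (h M hM)

/-- Invariant pseudometrics that separate points force equicontinuity: each pair outside the
relation has some `d_M > 0`, no pair with smaller `d_M` can be moved close to it, and compactness
reduces to finitely many `M`. A neighbourhood of the relation in `X × X` descends to one of the
diagonal because the product of the projections is closed. -/
theorem isEquicontinuous_factor_fibreRel : IsEquicontinuous T (fibreRel T ν).Factor := by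
  intro ε hε
  obtain ⟨O, hO, hdO, hOε⟩ := mem_nhdsSet_iff_exists.1 hε
  have hproj := (fibreRel T ν).isQuotientMap_proj
  have hcl : IsClosedMap (Prod.map (fibreRel T ν).proj (fibreRel T ν).proj) :=
    (hproj.continuous.prodMap hproj.continuous).isClosedMap
  suffices h : ∃ δ : Set (X × X), IsOpen δ ∧ (∀ x y, (fibreRel T ν).r x y → (x, y) ∈ δ) ∧
      ∀ p ∈ δ, ∀ t : T, (t • p.1, t • p.2) ∉ Prod.map (fibreRel T ν).proj (fibreRel T ν).proj ⁻¹' Oᶜ by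
    obtain ⟨δ, hδ, hrδ, h⟩ := h
    refine ⟨(Prod.map (fibreRel T ν).proj (fibreRel T ν).proj '' δᶜ)ᶜ,
      (hcl _ hδ.isClosed_compl).isOpen_compl.mem_nhdsSet.2 ?_, ?_⟩
    · rintro ⟨a, b⟩ (hab : a = b) ⟨⟨x, y⟩, hxy, he⟩
      subst hab
      rw [Prod.map_apply, Prod.mk.injEq] at he
      exact hxy (hrδ x y ((fibreRel T ν).proj_eq_iff.1 (he.1.trans he.2.symm)))
    · rintro ⟨a, b⟩ hab t
      obtain ⟨x, rfl⟩ := hproj.surjective a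
      obtain ⟨y, rfl⟩ := hproj.surjective b
      refine hOε (not_not.1 (h (x, y) (by_contra fun hxy => hab ⟨(x, y), hxy, rfl⟩) t))
  have hK : IsCompact (Prod.map (fibreRel T ν).proj (fibreRel T ν).proj ⁻¹' Oᶜ) :=
    (hO.isClosed_compl.preimage (hproj.continuous.prodMap hproj.continuous)).isCompact
  refine hK.induction_on (p := fun K => ∃ δ : Set (X × X), IsOpen δ ∧
    (∀ x y, (fibreRel T ν).r x y → (x, y) ∈ δ) ∧ ∀ p ∈ δ, ∀ t : T, (t • p.1, t • p.2) ∉ K) ?_ ?_ ?_ ?_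
  · exact ⟨univ, isOpen_univ, fun _ _ _ => mem_univ _, fun _ _ _ h => h⟩
  · rintro s s' hs ⟨δ, hδ, hr, h⟩
    exact ⟨δ, hδ, hr, fun p hp t hm => h p hp t (hs hm)⟩
  · rintro s s' ⟨δ, hδ, hr, h⟩ ⟨δ', hδ', hr', h'⟩
    exact ⟨δ ∩ δ', hδ.inter hδ', fun x y hxy => ⟨hr x y hxy, hr' x y hxy⟩,
      fun p hp t hm => hm.elim (h p hp.1 t) (h' p hp.2 t)⟩
  · rintro ⟨x, y⟩ hxy
    obtain ⟨M, hM, hne⟩ : ∃ M, IsClosedInvariant T M ∧ fibreDist ν M x y ≠ 0 := by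
      by_contra! hcon
      exact hxy (hdO ((fibreRel T ν).proj_eq_iff.2 hcon))
    have hpos : 0 < fibreDist ν M x y := (fibreDist_nonneg ν M x y).lt_of_ne' hne
    have hc := hM.continuous_fibreDist (T := T) ν
    refine ⟨{p | fibreDist ν M x y / 2 < fibreDist ν M p.1 p.2}, mem_nhdsWithin_of_mem_nhds
      ((isOpen_lt continuous_const hc).mem_nhds (half_lt_self hpos)),
      {p | fibreDist ν M p.1 p.2 < fibreDist ν M x y / 2}, isOpen_lt hc continuous_const,
      fun a b hab => ?_, fun p hp t hm => ?_⟩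
    · exact (hab M hM).trans_lt (half_pos hpos)
    · have hm' : fibreDist ν M x y / 2 < fibreDist ν M (t • p.1) (t • p.2) := hm
      rw [hM.fibreDist_smul ν] at hm'
      exact lt_asymm hm' hp

end Minimal

/-! ### The regionally proximal relation and almost automorphic points -/

section Main

variable {T X : Type*} [Monoid T] [TopologicalSpace X] [CompactSpace X] [T2Space X]
  [MulAction T X] [ContinuousConstSMul T X] [MeasurableSpace X] [BorelSpace X]

/-- Regionally proximal points are identified in every equicontinuous factor. -/
theorem rel_of_mem_Q [MulAction.IsMinimal T X] (ν : Measure X) [IsFiniteMeasure ν]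
    [ν.IsOpenPosMeasure] [ν.OuterRegular]
    [SMulInvariantMeasure T X ν] {x x' : X} (h : x' ∈ Q T x) (R : ClosedInvariantRel T X)
    (hR : IsEquicontinuous T R.Factor) : R.r x x' := by
  by_contra hxx'
  have hne : (R.proj x', R.proj x) ∉ diagonal R.Factor := fun he =>
    hxx' (R.symm (R.proj_eq_iff.1 he))
  obtain ⟨N, W, hN, hW, hxN, hdW, hNW⟩ := normal_separation
    (isClosed_singleton (x := (R.proj x', R.proj x))) (isClosed_diagonal (X := R.Factor))
    (disjoint_singleton_left.2 hne)
  have hπ : Continuous R.proj := R.isQuotientMap_proj.continuous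
  -- These are the pairs whose orbit downstairs avoids `N`, a neighbourhood of the image of `(x',
  -- x)`. By equicontinuity the fibre over `x` contains a neighbourhood of `x`; distance zero
  -- carries it into the fibre over `x'`, and then `(x', x)` avoids `N` at time `1`, which is
  -- absurd.
  have hM : IsClosedInvariant T
      {p : X × X | ∀ t : T, (R.proj (t • p.1), R.proj (t • p.2)) ∈ Nᶜ} := by
    refine ⟨?_, fun s a b hab t => ?_⟩
    · simp only [Set.ofPred_forall]
      exact isClosed_iInter fun t => hN.isClosed_compl.preimage (by fun_prop)
    · simpa only [mul_smul] using hab (t * s)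
  obtain ⟨δ, hδ, hδW⟩ := hR W (hW.mem_nhdsSet.2 hdW)
  have hU : {z | (R.proj x, R.proj z) ∈ δ} ∈ 𝓝 x :=
    hπ.continuousAt.preimage_mem_nhds (mem_nhds_of_mem_entourages hδ (R.proj x))
  have hx := subset_fibre_of_fibreDist_eq_zero ν hM.isClosed (fibreDist_eq_zero_of_mem_Q ν hM h)
    isOpen_interior (interior_subset.trans fun z (hz : (R.proj x, R.proj z) ∈ δ) (t : T) hzN =>
      Set.disjoint_left.1 hNW hzN (hδW _ hz t)) (mem_interior_iff_mem_nhds.2 hU) 1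
  simp only [one_smul] at hx
  exact hx (hxN rfl)

/-- The facts about the regionally proximal relation: it is the equicontinuous structure relation,
and it is given by return times. -/
theorem D_eq_Q_and_mem_Q_iff (hmin : MulAction.IsMinimal T X) (hbi : IsBicontinuous T X)
    (hinv : AdmitsInvariantMeasure T X) (x : X) :
    D T x = Q T x ∧ ∀ x', x' ∈ Q T x ↔ (eqStructureRel T X).r x x' := by
  obtain ⟨ν, hreg, hprob, hν⟩ := hinv.exists_regular
  have hpos : ν.IsOpenPosMeasure := isOpenPosMeasure_of_isMinimal (T := T) ν
  have h1 : ∀ x', x' ∈ Q T x → (eqStructureRel T X).r x x' := fun x' h R hR => rel_of_mem_Q ν h R hR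
  have h2 : ∀ x', (eqStructureRel T X).r x x' → x' ∈ D T x := fun x' h =>
    mem_D_of_fibreDist_eq_zero ν hbi.isOpenMap_smul
      (eqStructureRel_le _ (isEquicontinuous_factor_fibreRel ν) h)
  exact ⟨(D_subset_Q x).antisymm fun x' h => h2 x' (h1 x' h),
    fun x' => ⟨h1 x', fun h => D_subset_Q x (h2 x' h)⟩⟩

theorem closure_V_eq_D (hmin : MulAction.IsMinimal T X) (hbi : IsBicontinuous T X)
    (hinv : AdmitsInvariantMeasure T X) (x : X) : D T x = closure (V T x) :=
  (D_subset_closure_V hbi.isOpenMap_smul x).antisymm <| closure_minimal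
    ((V_subset_Q x).trans (D_eq_Q_and_mem_Q_iff hmin hbi hinv x).1.ge) (isClosed_D x)

theorem isAlmostAutomorphicPt_iff_eqStructureRel (hmin : MulAction.IsMinimal T X)
    (hbi : IsBicontinuous T X) (hinv : AdmitsInvariantMeasure T X) (x : X) :
    IsAlmostAutomorphicPt T x ↔ ∀ x', (eqStructureRel T X).r x x' → x' = x := by
  obtain ⟨h1, h2⟩ := D_eq_Q_and_mem_Q_iff hmin hbi hinv x
  have h3 := closure_V_eq_D hmin hbi hinv x
  rw [isAlmostAutomorphicPt_iff]
  constructor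
  · intro h x' hx'
    rw [← h2, ← h1, h3, h, closure_singleton] at hx'
    exact hx'
  · refine fun h => Subset.antisymm (fun x' hx' => h x' ?_) (singleton_subset_iff.2 (self_mem_V x))
    exact (h2 x').1 (V_subset_Q x hx')

theorem isAlmostAutomorphic_iff_isAlmostOneToOne (hmin : MulAction.IsMinimal T X)
    (hbi : IsBicontinuous T X) (hinv : AdmitsInvariantMeasure T X) :
    IsAlmostAutomorphic T X ↔ IsAlmostOneToOne T (projEq T X) := by
  have key := isAlmostAutomorphicPt_iff_eqStructureRel hmin hbi hinv
  constructor
  · rintro ⟨x, hx, -⟩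
    refine ⟨(eqStructureRel T X).isEpimorphism_proj, projEq T X x, x,
      Subset.antisymm (fun x' hx' => ?_) (singleton_subset_iff.2 rfl)⟩
    exact (key x).1 hx x' ((eqStructureRel T X).symm ((eqStructureRel T X).proj_eq_iff.1 hx'))
  · rintro ⟨-, y, x, hxy⟩
    refine ⟨x, (key x).2 fun x' hx' => ?_, MulAction.dense_orbit T x⟩
    have hx : projEq T X x = y := (hxy.ge rfl : x ∈ projEq T X ⁻¹' {y})
    exact hxy.le (((eqStructureRel T X).proj_eq_iff.2 hx').symm.trans hx)

theorem setOf_isAlmostAutomorphicPt_mem_residual (hmin : MulAction.IsMinimal T X)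
    (hbi : IsBicontinuous T X) (hinv : AdmitsInvariantMeasure T X)
    (hX : TopologicalSpace.MetrizableSpace X) (haa : IsAlmostAutomorphic T X) :
    {x : X | IsAlmostAutomorphicPt T x} ∈ residual X := by
  let _ : MetricSpace X := TopologicalSpace.metrizableSpaceMetric X
  have key := isAlmostAutomorphicPt_iff_eqStructureRel hmin hbi hinv
  obtain ⟨x, hx, hd⟩ := haa
  have hdense : Dense {x : X | IsAlmostAutomorphicPt T x} :=
    hd.mono (range_subset_iff.2 fun t => hx.smul hbi.1 t)
  refine residual_of_dense_Gδ ?_ hdense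
  -- A point fails to be almost automorphic when its class in `S_eq` contains a point at distance at
  -- least `1 / (n + 1)` for some `n`. For each `n` such points form a closed set, a projection of a
  -- compact one.
  have heq : {x : X | IsAlmostAutomorphicPt T x} =
      ⋂ n : ℕ, (Prod.fst '' ({p : X × X | (eqStructureRel T X).r p.1 p.2} ∩
        {p | 1 / ((n : ℝ) + 1) ≤ dist p.1 p.2}))ᶜ := by
    ext x
    rw [mem_ofPred_eq, key, mem_iInter]
    constructor
    · rintro h n ⟨⟨a, b⟩, ⟨h1, h2⟩, rfl⟩
      obtain rfl : b = a := h b h1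
      rw [mem_ofPred_eq, dist_self] at h2
      exact Nat.one_div_pos_of_nat.not_ge h2
    · intro h x' hx'
      by_contra hne
      obtain ⟨n, hn⟩ := exists_nat_one_div_lt (dist_pos.2 (Ne.symm hne))
      exact h n ⟨(x, x'), ⟨hx', hn.le⟩, rfl⟩
  rw [heq]
  refine IsGδ.iInter_of_isOpen fun n => (isClosedMap_fst_of_compactSpace _ ?_).isOpen_compl
  exact (eqStructureRel T X).isClosed.inter (isClosed_le continuous_const continuous_dist)

end Main

end Semiflow

theorem theorem1p15 {T X : Type*} [Monoid T] [TopologicalSpace T] [ContinuousMul T]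
    [TopologicalSpace X] [CompactSpace X] [T2Space X] [MulAction T X] [ContinuousSMul T X]
    [MeasurableSpace X] [BorelSpace X]
    (hmin : MulAction.IsMinimal T X)
    (hbi : Semiflow.IsBicontinuous T X)
    (hinv : Semiflow.AdmitsInvariantMeasure T X) :
    (∀ x : X, Semiflow.D T x = Semiflow.Q T x) ∧
    (Semiflow.IsInvertible T X →
      ∀ x : X, Semiflow.Q T x = Semiflow.D T x ∧ Semiflow.D T x = closure (Semiflow.V T x)) ∧
    (Semiflow.IsAlmostAutomorphic T X ↔ Semiflow.IsAlmostOneToOne T (Semiflow.projEq T X)) ∧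
    (TopologicalSpace.MetrizableSpace X → Semiflow.IsAlmostAutomorphic T X →
      {x : X | Semiflow.IsAlmostAutomorphicPt T x} ∈ residual X) := by
  exact ⟨fun x => (Semiflow.D_eq_Q_and_mem_Q_iff hmin hbi hinv x).1,
    fun _ x => ⟨(Semiflow.D_eq_Q_and_mem_Q_iff hmin hbi hinv x).1.symm,
      Semiflow.closure_V_eq_D hmin hbi hinv x⟩,
    Semiflow.isAlmostAutomorphic_iff_isAlmostOneToOne hmin hbi hinv,
    Semiflow.setOf_isAlmostAutomorphicPt_mem_residual hmin hbi hinv⟩
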